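/- **Setting.** Let $T>0$, $t_k=kT$. The plant state $x\in\mathbb R^n$ and the planner state $\bar x\in\mathbb R^n$ satisfy, between consecutive transition times, $$\dot x=f(x)+g(x)(u+v),\qquad \dot{\bar x}=A\bar x+Bv,\qquad t\in(t_k,t_{k+1}),$$ with $f,g$ locally Lipschitz, and for $k\ge 1$ the jumps $x^+(t_k)=\bar x^+(t_k)=\Delta(x^-(t_k))$, where $\Delta(x)=Dx+p$ is affine. Trajectories are right continuous at the $t_k$, and $\bar x(0)=x(0)$. The constraints are $$x(t)\in\mathcal X_c\ (t\ne t_k),\qquad x^+(t_k)\in\mathcal X_d\subseteq\mathcal X_c\ (k\ge 0),\qquad u(t)\in\mathcal U,\ v(t)\in\mathcal V\ (t\ge 0).$$ Let $h_x,h_e:\mathbb R^n\to\mathbb R$ be continuously differentiable, $\mathcal S_x=\{h_x\ge0\}\subseteq\mathcal X_c$, $\mathcal S_e=\{h_e\ge 0\}\ni 0$, with $\nabla h_x\neq0$ on $\partial\mathcal S_x$ and $\nabla h_e\ne0$ on $\partial\mathcal S_e$. Write $\boldsymbol z=(x,\bar x)$, $F(\boldsymbol z,u,v)=(f(x)+g(x)(u+v),\,A\bar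 x+Bv)$, $V(\boldsymbol z)=(x-\bar x)^\top Q_v(x-\bar x)$ and $\mathcal I=\{\boldsymbol z: x\in\mathcal S_x,\ x-\bar x\in\mathcal S_e\}$. **Low level policy.** Let $c_1,c_2>0$ and let $\alpha_1,\alpha_2:\mathbb R\to\mathbb R$ be strictly increasing and vanish at $0$. Wherever the quadratic program $$\min_{u\in\mathcal U,\ \gamma\in\mathbb R}\ \|u\|^2+c_1\gamma^2\quad\text{s.t.}\quad \tfrac{\partial V}{\partial\boldsymbol z}F\le -c_2V+\gamma,\quad \tfrac{\partial h_x}{\partial x}\big(f+g(u+v)\big)\ge-\alpha_1(h_x),\quad \tfrac{\partial h_e(x-\bar x)}{\partial\boldsymbol z}F\ge-\alpha_2(h_e(x-\bar x))$$ is feasible, $\pi^u(\boldsymbol z,v)$ is the input $u$ of an optimal solution. Assume that the program is feasible for all $\boldsymbol z\in\mathcal I$ and $v\in\mathcal V$, and that for each $v\in\mathcal V$ the map $\pi^u(\cdot,v)$ is Lipschitz on a neighborhood of each point of $\mathcal I$. **High level policy.** Let $\bar A=e^{AT}$, $\bar B=\int_0^Te^{A(T-\eta)}B\,d\eta$, let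 $K$ be a feedback gain, $\bar{\mathcal S}_e\supseteq\mathcal S_e$, $\mathcal W=\Delta(\bar{\mathcal S}_e)$, $\mathcal E_0=\{0\}$, $\mathcal E_{j+1}=D(\bar A+\bar BK)\mathcal E_j\oplus\mathcal W$. For a horizon $N\ge1$ and a state $x_0$, consider the problem of minimizing $$\sum_{j=0}^N\big(\|x_j-x_g\|_Q+\|v_j\|_R\big)+\|x_N-x_g\|_{Q_f},\qquad \|y\|_Q=y^\top Qy,$$ subject to: the initial state $x_0$ is the given one; $x_{j+1}=D(\bar A+\bar BK)x_j+D\bar Bv_j$ for $0\le j<N$; $x_j\in(\mathcal X_d\cap\mathcal S_x)\ominus\mathcal E_j$ and $v_j+Kx_j\in\mathcal V\ominus K\mathcal E_j$ for $0\le j\le N$; and $x_N\in\mathcal X_F\ominus\mathcal E_N$. Here $\oplus$ and $\ominus$ are the Minkowski sum and the Pontryagin difference. Wherever this problem is feasible, $\pi^v(x_0)=v_0^*+Kx_0$ for an optimal solution $(x_j^*,v_j^*)$. Assume that the terminal set is admissible, $\mathcal X_F\subseteq\mathcal X_d\cap\mathcal S_x$ and $K\mathcal X_F\subseteq\mathcal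 V$, and robustly positively invariant: $D(\bar A+\bar BK)x+w\in\mathcal X_F$ for all $x\in\mathcal X_F$, $w\in\mathcal W$. **Closed loop.** $u(t)=\pi^u(x(t),\bar x(t),v(t))$ for $t\in(t_k,t_{k+1})$ and for $t=0$; $u(t_k)=u^-(t_k)$ for $k\ge1$; and $v(t)=\pi^v(x^+(t_k))$ for $t\in[t_k,t_{k+1})$. **Theorem.** If the optimal control problem is feasible at $t=0$, that is, for $x_0=x(0)$, then every closed-loop trajectory satisfies the state and input constraints above for all $t\ge0$ (and a trajectory that exists only on $[0,\tau)$ satisfies them for all $t\in[0,\tau)$). -/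

import Mathlib

open Set Filter Topology
open scoped Pointwise

/-- Data of the two-layer control architecture: `n` is the state dimension, `d` the input
dimension. Matrices are linear maps between Euclidean spaces. This structure carries no
hypotheses. -/
structure MultiRate (n d : ℕ) where
  /-- period of the high level updates: the discontinuous transitions occur at `k * T` -/
  T : ℝ
  /-- drift of the plant -/
  f : EuclideanSpace ℝ (Fin n) → EuclideanSpace ℝ (Fin n)
  /-- input matrix of the plant -/
  g : EuclideanSpace ℝ (Fin n) → (EuclideanSpace ℝ (Fin d) →L[ℝ] EuclideanSpace ℝ (Fin n))
  /-- linear part of the affine reset map -/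
  D : EuclideanSpace ℝ (Fin n) →L[ℝ] EuclideanSpace ℝ (Fin n)
  /-- offset of the affine reset map -/
  p : EuclideanSpace ℝ (Fin n)
  /-- state matrix of the linear planning model -/
  A : EuclideanSpace ℝ (Fin n) →L[ℝ] EuclideanSpace ℝ (Fin n)
  /-- input matrix of the linear planning model -/
  B : EuclideanSpace ℝ (Fin d) →L[ℝ] EuclideanSpace ℝ (Fin n)
  /-- continuous-time state constraint set -/
  Xc : Set (EuclideanSpace ℝ (Fin n))
  /-- state constraint set at the discontinuous transitions -/
  Xd : Set (EuclideanSpace ℝ (Fin n))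
  /-- constraint set of the low level input -/
  U : Set (EuclideanSpace ℝ (Fin d))
  /-- constraint set of the high level input -/
  V : Set (EuclideanSpace ℝ (Fin d))
  /-- barrier function of the state -/
  hx : EuclideanSpace ℝ (Fin n) → ℝ
  /-- barrier function of the tracking error -/
  he : EuclideanSpace ℝ (Fin n) → ℝ
  /-- gain of the barrier condition for `hx` -/
  α₁ : ℝ → ℝ
  /-- gain of the barrier condition for `he` -/
  α₂ : ℝ → ℝ
  /-- weight of the Lyapunov function -/
  Qv : EuclideanSpace ℝ (Fin n) →L[ℝ] EuclideanSpace ℝ (Fin n)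
  /-- weight of the slack variable -/
  c₁ : ℝ
  /-- decay rate in the Lyapunov condition -/
  c₂ : ℝ
  /-- outer approximation of the error set -/
  SeBar : Set (EuclideanSpace ℝ (Fin n))
  /-- prediction horizon -/
  N : ℕ
  /-- feedback gain of the tube -/
  K : EuclideanSpace ℝ (Fin n) →L[ℝ] EuclideanSpace ℝ (Fin d)
  /-- terminal set -/
  XF : Set (EuclideanSpace ℝ (Fin n))
  /-- goal state -/
  xg : EuclideanSpace ℝ (Fin n)
  /-- stage weight of the state -/
  Q : EuclideanSpace ℝ (Fin n) →L[ℝ] EuclideanSpace ℝ (Fin n)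
  /-- stage weight of the input -/
  R : EuclideanSpace ℝ (Fin d) →L[ℝ] EuclideanSpace ℝ (Fin d)
  /-- terminal weight -/
  Qf : EuclideanSpace ℝ (Fin n) →L[ℝ] EuclideanSpace ℝ (Fin n)

/-- Extended class-`𝓚` functions: strictly increasing, zero at zero. -/
structure IsExtendedClassK (α : ℝ → ℝ) : Prop where
  strictMono : StrictMono α
  map_zero : α 0 = 0

/-- Pontryagin difference `P ⊖ S`. -/
def pontryaginDiff {E : Type*} [Add E] (P S : Set E) : Set E :=
  {x | ∀ s ∈ S, x + s ∈ P}

namespace MultiRate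

variable {n d : ℕ} (S : MultiRate n d)

/-- The affine reset map `Δ`. -/
def reset (x : EuclideanSpace ℝ (Fin n)) : EuclideanSpace ℝ (Fin n) := S.D x + S.p

/-- The safe set `S_x = {h_x ≥ 0}`. -/
def Sx : Set (EuclideanSpace ℝ (Fin n)) := {x | 0 ≤ S.hx x}

/-- The error set `S_e = {h_e ≥ 0}`. -/
def Se : Set (EuclideanSpace ℝ (Fin n)) := {e | 0 ≤ S.he e}

/-- The set `I` of pairs `(x, x̄)` with `x ∈ S_x` and `x - x̄ ∈ S_e`. -/
def safePairs : Set (EuclideanSpace ℝ (Fin n) × EuclideanSpace ℝ (Fin n)) :=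
  {z | z.1 ∈ S.Sx ∧ z.1 - z.2 ∈ S.Se}

/-- Right-hand side of the augmented continuous dynamics:
`ẋ = f(x) + g(x)(u + v)` and `x̄' = A x̄ + B v`. -/
def augField (z : EuclideanSpace ℝ (Fin n) × EuclideanSpace ℝ (Fin n))
    (u v : EuclideanSpace ℝ (Fin d)) :
    EuclideanSpace ℝ (Fin n) × EuclideanSpace ℝ (Fin n) :=
  (S.f z.1 + S.g z.1 (u + v), S.A z.2 + S.B v)

/-! ### Low level: the CLF-CBF quadratic program -/

/-- Candidate Lyapunov function `(x - x̄)ᵀ Q_v (x - x̄)`. -/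
noncomputable def clf (z : EuclideanSpace ℝ (Fin n) × EuclideanSpace ℝ (Fin n)) : ℝ :=
  inner ℝ (z.1 - z.2) (S.Qv (z.1 - z.2))

/-- `(u, γ)` satisfies the constraints of the quadratic program at `z = (x, x̄)` and `v`. -/
structure QPFeasible (z : EuclideanSpace ℝ (Fin n) × EuclideanSpace ℝ (Fin n))
    (v u : EuclideanSpace ℝ (Fin d)) (γ : ℝ) : Prop where
  input : u ∈ S.U
  lyapunov : fderiv ℝ S.clf z (S.augField z u v) ≤ -S.c₂ * S.clf z + γ
  state_barrier : -S.α₁ (S.hx z.1) ≤ fderiv ℝ S.hx z.1 (S.f z.1 + S.g z.1 (u + v))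
  error_barrier : -S.α₂ (S.he (z.1 - z.2)) ≤
    fderiv ℝ (fun y : EuclideanSpace ℝ (Fin n) × EuclideanSpace ℝ (Fin n) => S.he (y.1 - y.2)) z
      (S.augField z u v)

/-- Objective of the quadratic program. -/
noncomputable def qpCost (u : EuclideanSpace ℝ (Fin d)) (γ : ℝ) : ℝ := ‖u‖ ^ 2 + S.c₁ * γ ^ 2

/-- `(u, γ)` is an optimal solution of the quadratic program at `z = (x, x̄)` and `v`. -/
def QPOptimal (z : EuclideanSpace ℝ (Fin n) × EuclideanSpace ℝ (Fin n))
    (v u : EuclideanSpace ℝ (Fin d)) (γ : ℝ) : Prop :=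
  S.QPFeasible z v u γ ∧ ∀ u' γ', S.QPFeasible z v u' γ' → S.qpCost u γ ≤ S.qpCost u' γ'

/-- `πu` is the low level policy: where the quadratic program is feasible, `πu` returns the input
of an optimal solution. Nothing is required where it is infeasible. -/
def IsLowLevelPolicy
    (πu : EuclideanSpace ℝ (Fin n) × EuclideanSpace ℝ (Fin n) → EuclideanSpace ℝ (Fin d) →
      EuclideanSpace ℝ (Fin d)) : Prop :=
  ∀ z v, (∃ u γ, S.QPFeasible z v u γ) → ∃ γ, S.QPOptimal z v (πu z v) γ

/-! ### High level: robust tube model predictive control -/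

/-- `Ā = exp(A T)`. -/
noncomputable def Abar : EuclideanSpace ℝ (Fin n) →L[ℝ] EuclideanSpace ℝ (Fin n) :=
  NormedSpace.exp (S.T • S.A)

/-- `B̄ = ∫₀ᵀ exp(A (T - η)) B dη`. -/
noncomputable def Bbar : EuclideanSpace ℝ (Fin d) →L[ℝ] EuclideanSpace ℝ (Fin n) :=
  ∫ η in (0 : ℝ)..S.T, (NormedSpace.exp ((S.T - η) • S.A)).comp S.B

/-- Closed-loop matrix of the sampled nominal model under the gain `K`: the linear part of the
reset map, composed with `Ā + B̄ K`. -/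
noncomputable def Acl : EuclideanSpace ℝ (Fin n) →L[ℝ] EuclideanSpace ℝ (Fin n) :=
  S.D.comp (S.Abar + S.Bbar.comp S.K)

/-- The disturbance set `Δ(S̄_e)`. -/
def W : Set (EuclideanSpace ℝ (Fin n)) := S.reset '' S.SeBar

/-- Cross sections of the tube, indexed by the prediction step. -/
noncomputable def tube : ℕ → Set (EuclideanSpace ℝ (Fin n))
  | 0 => {0}
  | j + 1 => S.Acl '' tube j + S.W

/-- The predicted states `xs 0, …, xs N` and decision variables `vs 0, …, vs N` satisfy the
constraints of the finite time optimal control problem with initial state `x₀`. Prediction step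
`j` is `j` periods ahead of the current time. The entries of the sequences beyond `N` play no
role. -/
structure OCPFeasible (x₀ : EuclideanSpace ℝ (Fin n)) (xs : ℕ → EuclideanSpace ℝ (Fin n))
    (vs : ℕ → EuclideanSpace ℝ (Fin d)) : Prop where
  init : xs 0 = x₀
  dyn : ∀ j < S.N, xs (j + 1) = S.Acl (xs j) + S.D (S.Bbar (vs j))
  state : ∀ j ≤ S.N, xs j ∈ pontryaginDiff (S.Xd ∩ S.Sx) (S.tube j)
  input : ∀ j ≤ S.N, vs j + S.K (xs j) ∈ pontryaginDiff S.V (S.K '' S.tube j)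
  terminal : xs S.N ∈ pontryaginDiff S.XF (S.tube S.N)

/-- Objective of the finite time optimal control problem. -/
noncomputable def ocpCost (xs : ℕ → EuclideanSpace ℝ (Fin n))
    (vs : ℕ → EuclideanSpace ℝ (Fin d)) : ℝ :=
  (∑ j ∈ Finset.range (S.N + 1),
    (inner ℝ (xs j - S.xg) (S.Q (xs j - S.xg)) + inner ℝ (vs j) (S.R (vs j)))) +
  inner ℝ (xs S.N - S.xg) (S.Qf (xs S.N - S.xg))

/-- Optimal solutions of the finite time optimal control problem. -/
def OCPOptimal (x₀ : EuclideanSpace ℝ (Fin n)) (xs : ℕ → EuclideanSpace ℝ (Fin n))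
    (vs : ℕ → EuclideanSpace ℝ (Fin d)) : Prop :=
  S.OCPFeasible x₀ xs vs ∧
    ∀ xs' vs', S.OCPFeasible x₀ xs' vs' → S.ocpCost xs vs ≤ S.ocpCost xs' vs'

/-- `πv` is the high level policy: where the finite time optimal control problem is feasible, it
returns `v₀ + K x₀` for an optimal solution. Nothing is required where it is infeasible. -/
def IsHighLevelPolicy (πv : EuclideanSpace ℝ (Fin n) → EuclideanSpace ℝ (Fin d)) : Prop :=
  ∀ x₀, (∃ xs vs, S.OCPFeasible x₀ xs vs) →
    ∃ xs vs, S.OCPOptimal x₀ xs vs ∧ πv x₀ = vs 0 + S.K (xs 0)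

/-- `X` is robust positively invariant for `x(k+1) = D (Ā + B̄ K) x(k) + w(k)` with
`w(k) ∈ Δ(S̄_e)`. -/
def IsRobustPosInvariant (X : Set (EuclideanSpace ℝ (Fin n))) : Prop :=
  ∀ x ∈ X, ∀ w ∈ S.W, S.Acl x + w ∈ X

/-! ### Closed loop -/

/-- `(x, xb, u, v)` is a trajectory on `[0, τ)` of the augmented system in closed loop with the
policies `πu` and `πv`. The states `x` and `xb` are right continuous at the transition times
`k * T`, so that `x⁺ = x (k * T)` and `x̄⁺ = xb (k * T)`. -/
structure IsClosedLoop
    (πu : EuclideanSpace ℝ (Fin n) × EuclideanSpace ℝ (Fin n) → EuclideanSpace ℝ (Fin d) →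
      EuclideanSpace ℝ (Fin d))
    (πv : EuclideanSpace ℝ (Fin n) → EuclideanSpace ℝ (Fin d)) (τ : EReal)
    (x xb : ℝ → EuclideanSpace ℝ (Fin n)) (u v : ℝ → EuclideanSpace ℝ (Fin d)) : Prop where
  /-- between transitions the augmented state follows the continuous dynamics -/
  flow : ∀ (k : ℕ) (t : ℝ), k * S.T < t → t < (k + 1) * S.T → (t : EReal) < τ →
    HasDerivAt (fun s => (x s, xb s)) (S.augField (x t, xb t) (u t) (v t)) t
  /-- between transitions `u` is given by the low level policy -/
  low : ∀ (k : ℕ) (t : ℝ), k * S.T < t → t < (k + 1) * S.T → (t : EReal) < τ →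
    u t = πu (x t, xb t) (v t)
  /-- `v⁺ = πv(x⁺)` at the transitions, and `v` is constant until the next one -/
  high : ∀ (k : ℕ) (t : ℝ), k * S.T ≤ t → t < (k + 1) * S.T → (t : EReal) < τ →
    v t = πv (x (k * S.T))
  right_x : ∀ k : ℕ, ((k * S.T : ℝ) : EReal) < τ →
    Tendsto x (𝓝[>] (k * S.T)) (𝓝 (x (k * S.T)))
  right_xb : ∀ k : ℕ, ((k * S.T : ℝ) : EReal) < τ →
    Tendsto xb (𝓝[>] (k * S.T)) (𝓝 (xb (k * S.T)))
  /-- the left limit `x⁻` exists at the transitions, the plant jumps to `x⁺ = Δ(x⁻)`, and the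
  planner state is reset to the same value, `x̄⁺ = Δ(x⁻)` -/
  jump : ∀ k : ℕ, 1 ≤ k → ((k * S.T : ℝ) : EReal) < τ →
    ∃ xm, Tendsto x (𝓝[<] (k * S.T)) (𝓝 xm) ∧
      x (k * S.T) = S.reset xm ∧ xb (k * S.T) = S.reset xm
  /-- at the transitions `u` keeps its left limit, `u⁺ = u⁻` -/
  jump_u : ∀ k : ℕ, 1 ≤ k → ((k * S.T : ℝ) : EReal) < τ →
    Tendsto u (𝓝[<] (k * S.T)) (𝓝 (u (k * S.T)))
  /-- the planner starts at the state of the plant -/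
  init_xb : xb 0 = x 0
  /-- the first input is given by the low level policy -/
  init_u : u 0 = πu (x 0, xb 0) (v 0)

end MultiRate

/-! The proof is an induction over the periods; it carries feasibility of the optimal control
problem at the transition states. Suppose the problem is feasible at `x (k * T)`. The tube starts at
`{0}`, so nothing is tightened at prediction step 0: the state lies in `Xd ∩ Sx` and the input
returned by `πv` lies in `V`. The planner restarts at the plant state, so the error is `0 ∈ Se` and
the pair starts in `safePairs`. During the period `v` is constant, and the barrier constraints of
the quadratic program make the closed-loop field subtangential to the closed set `safePairs`. A
Nagumo argument (`mem_of_subtangential`) keeps the solution there: the distance to the set grows at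
most at a rate proportional to itself, so by Grönwall it stays zero. This gives the constraints
between transitions. At the end of the period the left limit of the error still lies in `Se`, by
closedness, and variation of constants (`tendsto_linear_ode`) gives the left limit of the planner.
Since the reset is affine, the new plant state is a nominal sampled step plus some `w ∈ W`
(`IsClosedLoop.exists_transition`). The old plan, shifted by one step and translated by the
propagated `w`, is feasible for the new state (`OCPFeasible.successor`), which closes the induction.
-/

/-! ### Forward invariance of closed sets -/

/-- If `G y` is subtangential to `I` at a point `y` nearest to `z t`, the distance to `I` along a
solution of `z' = G z` grows at `t` at most at the rate `L * infDist (z t) I`. -/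
theorem eventually_slope_infDist_lt {E : Type*} [NormedAddCommGroup E] [NormedSpace ℝ E]
    {I s : Set E} {G : E → E} {z : ℝ → E} {L : NNReal} {t r : ℝ} {y : E}
    (hG : LipschitzOnWith L G s) (hzs : z t ∈ s) (hys : y ∈ s)
    (hy : Metric.infDist (z t) I = dist (z t) y)
    (htan : ∀ ε > 0, ∀ᶠ δ in 𝓝[>] (0 : ℝ), Metric.infDist (y + δ • G y) I ≤ ε * δ)
    (hz : HasDerivWithinAt z (G (z t)) (Ici t) t)
    (hr : L * Metric.infDist (z t) I < r) :
    ∀ᶠ t' in 𝓝[>] t, (t' - t)⁻¹ * (Metric.infDist (z t') I - Metric.infDist (z t) I) < r := by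
  -- One `ε` pays for the remainder in the derivative of `z` at `t`, the other for the distance from
  -- `y + δ • G y` to `I`.
  obtain ⟨ε, hε, hεr⟩ : ∃ ε > 0, L * Metric.infDist (z t) I + 2 * ε < r :=
    ⟨(r - L * Metric.infDist (z t) I) / 3, by linarith, by linarith⟩
  have h1 : ∀ᶠ t' in 𝓝[>] t, ‖z t' - z t - (t' - t) • G (z t)‖ ≤ ε * ‖t' - t‖ :=
    nhdsWithin_mono _ Ioi_subset_Ici_self ((hasDerivWithinAt_iff_isLittleO.1 hz).def hε)
  have hshift : Tendsto (fun t' => t' - t) (𝓝[>] t) (𝓝[>] 0) := by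
    refine tendsto_nhdsWithin_iff.2 ⟨?_, ?_⟩
    · have : Tendsto (fun t' => t' - t) (𝓝 t) (𝓝 (t - t)) := (continuous_sub_right t).tendsto t
      rw [sub_self] at this
      exact this.mono_left nhdsWithin_le_nhds
    · filter_upwards [self_mem_nhdsWithin] with t' ht'
      exact sub_pos.2 (mem_Ioi.1 ht')
  filter_upwards [h1, hshift.eventually (htan ε hε), self_mem_nhdsWithin] with t' h1 h2 ht'
  have hpos : 0 < t' - t := sub_pos.2 (mem_Ioi.1 ht')
  rw [Real.norm_of_nonneg hpos.le] at h1
  have hlip : ‖G (z t) - G y‖ ≤ L * ‖z t - y‖ := by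
    simpa [dist_eq_norm] using hG.dist_le_mul _ hzs _ hys
  have h3 : dist (z t') (y + (t' - t) • G y) ≤
      ε * (t' - t) + ‖z t - y‖ + (t' - t) * (L * ‖z t - y‖) := by
    rw [dist_eq_norm]
    have : z t' - (y + (t' - t) • G y) =
        (z t' - z t - (t' - t) • G (z t)) + (z t - y) + (t' - t) • (G (z t) - G y) := by
      module
    rw [this]
    refine (norm_add₃_le).trans ?_
    rw [norm_smul, Real.norm_of_nonneg hpos.le]
    gcongr
  have h4 := Metric.infDist_le_infDist_add_dist (s := I) (x := z t') (y := y + (t' - t) • G y)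
  rw [inv_mul_lt_iff₀ hpos]
  rw [dist_eq_norm] at hy
  rw [hy] at hεr ⊢
  nlinarith

/-- Nagumo's theorem for a closed set, along a given solution: it suffices that the field is
Lipschitz near each point of the set and subtangential to it. -/
theorem mem_of_subtangential {E : Type*} [NormedAddCommGroup E] [NormedSpace ℝ E] [ProperSpace E]
    {I : Set E} (hI : IsClosed I) {G : E → E} {z : ℝ → E} {a b : ℝ}
    (hG : ∀ y ∈ I, ∃ L : NNReal, ∃ s ∈ 𝓝 y, LipschitzOnWith L G s)
    (htan : ∀ y ∈ I, ∀ ε > 0, ∀ᶠ δ in 𝓝[>] (0 : ℝ), Metric.infDist (y + δ • G y) I ≤ ε * δ)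
    (hcont : ContinuousOn z (Icc a b))
    (hz : ∀ t ∈ Ioo a b, HasDerivAt z (G (z t)) t) (ha : z a ∈ I) :
    ∀ t ∈ Icc a b, z t ∈ I := by
  have hclosed : IsClosed ({t | z t ∈ I} ∩ Icc a b) := by
    rw [inter_comm]
    exact hcont.preimage_isClosed_of_isClosed isClosed_Icc hI
  -- The differential equation is not assumed at `a`. The right derivative there is the limit of the
  -- derivatives `G (z t)`, because `G` is continuous at `z a`.
  have hright : ∀ t ∈ Ico a b, z t ∈ I ∨ t ∈ Ioo a b → HasDerivWithinAt z (G (z t)) (Ici t) t := by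
    intro t ht h
    rcases eq_or_lt_of_le ht.1 with rfl | hat
    · have hza : z a ∈ I := ha
      obtain ⟨L, s, hs, hL⟩ := hG _ hza
      have hca : Tendsto z (𝓝[>] a) (𝓝 (z a)) :=
        ((hcont a ⟨le_rfl, ht.2.le⟩).mono Ioo_subset_Icc_self).tendsto.mono_left
          (by rw [nhdsWithin_Ioo_eq_nhdsGT ht.2])
      have hGc : ContinuousAt G (z a) := hL.continuousOn.continuousAt hs
      refine hasDerivWithinAt_Ici_of_tendsto_deriv (s := Ioo a b) ?_ ?_ ?_ ?_
      · exact fun x hx => (hz x hx).differentiableAt.differentiableWithinAt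
      · exact (hcont a ⟨le_rfl, ht.2.le⟩).mono Ioo_subset_Icc_self
      · exact Ioo_mem_nhdsGT ht.2
      · refine (hGc.tendsto.comp hca).congr' ?_
        filter_upwards [Ioo_mem_nhdsGT ht.2] with x hx
        exact (hz x hx).deriv.symm
    · exact (hz t ⟨hat, ht.2⟩).hasDerivWithinAt
  -- Continuous induction: the times spent in `I` form a closed set, so it suffices to find such
  -- times immediately after each one.
  refine hclosed.Icc_subset_of_forall_exists_gt ha ?_
  rintro t₀ ⟨ht₀, ht₀I⟩ c hc
  have ht₀ : z t₀ ∈ I := ht₀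
  obtain ⟨L, s, hs, hL⟩ := hG _ ht₀
  obtain ⟨ρ, hρ, hρs⟩ := Metric.mem_nhds_iff.1 hs
  -- Half the radius, because the point of `I` nearest to `z t` is no farther from `z t` than `z t₀`
  -- is, and it too must lie in the ball of radius `ρ` where `G` is Lipschitz.
  have hnear : ∀ᶠ t in 𝓝[≥] t₀, z t ∈ Metric.ball (z t₀) (ρ / 2) := by
    have h : Tendsto z (𝓝[≥] t₀) (𝓝 (z t₀)) :=
      ((hcont t₀ ⟨ht₀I.1, ht₀I.2.le⟩).mono
        (Ico_subset_Icc_self.trans (Icc_subset_Icc_left ht₀I.1))).tendsto.mono_left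
        (by rw [nhdsWithin_Ico_eq_nhdsGE ht₀I.2])
    exact h (Metric.ball_mem_nhds _ (half_pos hρ))
  obtain ⟨t₁', ht₁', hball⟩ := (mem_nhdsGE_iff_exists_Icc_subset (a := t₀)).1 hnear
  obtain ⟨t₁, ht₁, hlt⟩ : ∃ t₁, t₀ < t₁ ∧ t₁ ≤ t₁' ∧ t₁ ≤ c ∧ t₁ ≤ b :=
    ⟨min t₁' (min c b), lt_min ht₁' (lt_min hc ht₀I.2), by simp⟩
  have key : ∀ t ∈ Icc t₀ t₁, Metric.infDist (z t) I ≤ gronwallBound 0 L 0 (t - t₀) := by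
    refine le_gronwallBound_of_liminf_deriv_right_le
      (f' := fun t => L * Metric.infDist (z t) I) ?_ ?_ ?_ ?_
    · exact (Metric.continuous_infDist_pt I).comp_continuousOn
        (hcont.mono (Icc_subset_Icc ht₀I.1 hlt.2.2))
    · intro t ht r hr
      obtain ⟨y, hyI, hy⟩ := hI.exists_infDist_eq_dist ⟨_, ht₀⟩ (z t)
      have hzt : dist (z t) (z t₀) < ρ / 2 := hball ⟨ht.1, ht.2.le.trans hlt.1⟩
      have hyt : dist (z t) y < ρ / 2 := hy ▸ (Metric.infDist_le_dist_of_mem ht₀).trans_lt hzt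
      refine (eventually_slope_infDist_lt (hL.mono hρs) (Metric.mem_ball.2 (by linarith))
        (Metric.mem_ball.2 ?_) hy (htan y hyI) ?_ hr).frequently
      · linarith [dist_triangle_left y (z t₀) (z t)]
      · refine hright t ⟨ht₀I.1.trans ht.1, ht.2.trans_le hlt.2.2⟩ ?_
        rcases eq_or_lt_of_le ht.1 with rfl | h
        · exact Or.inl ht₀
        · exact Or.inr ⟨ht₀I.1.trans_lt h, ht.2.trans_le hlt.2.2⟩
    · exact (Metric.infDist_zero_of_mem ht₀).le
    · intro t _
      simp
  refine ⟨t₁, ?_, ht₁, hlt.2.1⟩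
  have h0 := key t₁ ⟨ht₁.le, le_rfl⟩
  rw [gronwallBound_ε0_δ0] at h0
  exact (hI.mem_iff_infDist_zero ⟨_, ht₀⟩).2 (le_antisymm h0 Metric.infDist_nonneg)

/-- If the barrier condition holds at `y` in the direction `w`, and the superlevel set is regular at
`y`, then some correction `q` makes every `w + ε q` point into the superlevel set. -/
theorem exists_forall_eventually_nonneg {E : Type*} [NormedAddCommGroup E] [NormedSpace ℝ E]
    {h : E → ℝ} {y w : E} (hd : DifferentiableAt ℝ h y) (hy : 0 ≤ h y)
    (hw : h y = 0 → 0 ≤ fderiv ℝ h y w)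
    (hreg : y ∈ frontier {x | 0 ≤ h x} → fderiv ℝ h y ≠ 0) :
    ∃ q : E, ∀ ε > (0 : ℝ), ∀ᶠ δ in 𝓝[>] (0 : ℝ), 0 ≤ h (y + δ • (w + ε • q)) := by
  have hline : ∀ q : E, Tendsto (fun δ : ℝ => y + δ • q) (𝓝[>] 0) (𝓝 y) := by
    intro q
    have : Tendsto (fun δ : ℝ => y + δ • q) (𝓝 0) (𝓝 (y + (0 : ℝ) • q)) :=
      (by fun_prop : Continuous fun δ : ℝ => y + δ • q).tendsto 0
    rw [zero_smul, add_zero] at this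
    exact this.mono_left nhdsWithin_le_nhds
  -- The split is on the frontier rather than on `h y = 0`: `h` may vanish with zero gradient at an
  -- interior point of its superlevel set, where no correction is needed.
  by_cases hfr : y ∈ frontier {x | 0 ≤ h x}
  · obtain ⟨q, hq⟩ : ∃ q, 0 < fderiv ℝ h y q := by
      obtain ⟨q, hq⟩ := DFunLike.ne_iff.1 (hreg hfr)
      rcases lt_or_gt_of_ne hq with hq | hq
      · exact ⟨-q, by simpa using hq⟩
      · exact ⟨q, by simpa using hq⟩
    refine ⟨q, fun ε hε => ?_⟩
    rcases eq_or_lt_of_le hy with h0 | hpos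
    · have hder : HasDerivAt (fun δ : ℝ => h (y + δ • (w + ε • q)))
          (fderiv ℝ h y (w + ε • q)) 0 := by
        have h1 : HasDerivAt (fun δ : ℝ => y + δ • (w + ε • q)) (w + ε • q) 0 := by
          simpa using ((hasDerivAt_id (0 : ℝ)).smul_const (w + ε • q)).const_add y
        have h2 : HasFDerivAt h (fderiv ℝ h y) (y + (0 : ℝ) • (w + ε • q)) := by
          simpa using hd.hasFDerivAt
        exact h2.comp_hasDerivAt 0 h1
      have hpos : 0 < fderiv ℝ h y (w + ε • q) := by
        rw [map_add, map_smul, smul_eq_mul]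
        have := hw h0.symm
        positivity
      have hs := (hasDerivAt_iff_tendsto_slope.1 hder).eventually (lt_mem_nhds hpos)
      have hs' := nhdsWithin_mono (0 : ℝ) (fun x (hx : 0 < x) => (hx.ne' : x ∈ ({0} : Set ℝ)ᶜ)) hs
      filter_upwards [hs', self_mem_nhdsWithin] with δ hδ hδ0
      rw [slope_def_field] at hδ
      simp only [zero_smul, add_zero, ← h0, sub_zero] at hδ
      exact ((div_pos_iff_of_pos_right (mem_Ioi.1 hδ0)).1 hδ).le
    · exact ((hline (w + ε • q)).eventually (hd.continuousAt.eventually (lt_mem_nhds hpos))).mono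
        fun _ h => le_of_lt h
  · refine ⟨0, fun ε _ => (hline (w + ε • (0 : E))).eventually (p := fun x => 0 ≤ h x) ?_⟩
    have : y ∈ interior {x | 0 ≤ h x} := by
      by_contra hi
      exact hfr ⟨subset_closure hy, hi⟩
    exact mem_interior_iff_mem_nhds.1 this

/-! ### Variation of constants -/

/-- Left limit at `a + T` of a solution on `(a, a + T)` of a linear differential equation with
constant input. -/
theorem tendsto_linear_ode {E : Type*} [NormedAddCommGroup E] [NormedSpace ℝ E] [CompleteSpace E]
    (A : E →L[ℝ] E) (c : E) {y : ℝ → E} {a T : ℝ} (hT : 0 < T)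
    (hy : ∀ t ∈ Ioo a (a + T), HasDerivAt y (A (y t) + c) t)
    (ha : Tendsto y (𝓝[>] a) (𝓝 (y a))) :
    Tendsto y (𝓝[<] (a + T)) (𝓝 (NormedSpace.exp (T • A) (y a) +
      ∫ η in (0 : ℝ)..T, NormedSpace.exp ((T - η) • A) c)) := by
  let _ : NormedAlgebra ℚ (E →L[ℝ] E) := NormedAlgebra.restrictScalars ℚ ℝ _
  have hexp : Continuous fun s : ℝ => NormedSpace.exp (s • A) :=
    NormedSpace.exp_continuous.comp (continuous_id.smul continuous_const)
  have hint : Continuous fun s : ℝ => NormedSpace.exp ((a + T - s) • A) c :=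
    (hexp.comp (continuous_const.sub continuous_id)).clm_apply continuous_const
  -- The integrating factor `exp ((a + T - s) A)` cancels the term `A y` in the derivative.
  have hprim : ∀ t ∈ Ioo a (a + T), NormedSpace.exp ((a + T - t) • A) (y t) =
      NormedSpace.exp (T • A) (y a) + ∫ s in a..t, NormedSpace.exp ((a + T - s) • A) c := by
    intro t ht
    have hcy : ContinuousOn y (Icc a t) := by
      intro s hs
      rcases eq_or_lt_of_le hs.1 with rfl | has
      · exact (continuousWithinAt_Ioi_iff_Ici.1 ha).mono Icc_subset_Ici_self
      · exact (hy s ⟨has, hs.2.trans_lt ht.2⟩).continuousAt.continuousWithinAt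
    have := intervalIntegral.integral_eq_sub_of_hasDerivAt_of_le
      (f := fun s => NormedSpace.exp ((a + T - s) • A) (y s))
      (f' := fun s => NormedSpace.exp ((a + T - s) • A) c) ht.1.le
      ((hexp.comp (continuous_const.sub continuous_id)).continuousOn.clm_apply hcy) ?_
      (hint.intervalIntegrable _ _)
    · rw [this]
      simp
    · intro s hs
      have h1 : HasDerivAt (fun s : ℝ => NormedSpace.exp ((a + T - s) • A))
          (-(NormedSpace.exp ((a + T - s) • A) * A)) s := by
        have := (hasDerivAt_exp_smul_const A (a + T - s)).scomp s
          ((hasDerivAt_id' s).const_sub (a + T))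
        rw [neg_one_smul] at this
        exact this
      convert h1.clm_apply (hy s ⟨hs.1, hs.2.trans ht.2⟩) using 1
      simp
  have heq : (∫ s in a..(a + T), NormedSpace.exp ((a + T - s) • A) c) =
      ∫ η in (0 : ℝ)..T, NormedSpace.exp ((T - η) • A) c := by
    have := intervalIntegral.integral_comp_add_left (a := 0) (b := T)
      (fun s => NormedSpace.exp ((a + T - s) • A) c) a
    simp only [add_zero, add_sub_add_left_eq_sub] at this
    exact this.symm
  -- Nothing is assumed on `y` at `a + T`. Inverting the exponential solves `hprim` for `y t`, and
  -- the resulting expression is continuous up to and at `a + T`.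
  have hinv : ∀ s : ℝ, ∀ w : E, NormedSpace.exp (-(s • A)) (NormedSpace.exp (s • A) w) = w := by
    intro s w
    have : NormedSpace.exp (-(s • A)) * NormedSpace.exp (s • A) = 1 := by
      have h := NormedSpace.exp_add_of_commute (Commute.neg_left (Commute.refl (s • A)))
      rw [neg_add_cancel, NormedSpace.exp_zero] at h
      exact h.symm
    simpa using congrArg (fun M : E →L[ℝ] E => M w) this
  have hexp' : Continuous fun s : ℝ => NormedSpace.exp (-((a + T - s) • A)) :=
    NormedSpace.exp_continuous.comp
      ((continuous_const.sub continuous_id).smul continuous_const).neg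
  have hF : Continuous fun t : ℝ => NormedSpace.exp (-((a + T - t) • A))
      (NormedSpace.exp (T • A) (y a) + ∫ s in a..t, NormedSpace.exp ((a + T - s) • A) c) :=
    hexp'.clm_apply (continuous_const.add
      (intervalIntegral.continuous_primitive (fun _ _ => hint.intervalIntegrable _ _) a))
  have hlim := (hF.tendsto (a + T)).mono_left (nhdsWithin_le_nhds (s := Iio (a + T)))
  rw [heq] at hlim
  simp only [sub_self, zero_smul, neg_zero, NormedSpace.exp_zero,
    one_apply_eq_self] at hlim
  refine hlim.congr' ?_
  filter_upwards [Ioo_mem_nhdsLT (show a < a + T by linarith)] with t ht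
  rw [← hprim t ht, hinv]

/-! ### Lipschitz continuity of a control affine field under feedback -/

theorem exists_lipschitzOnWith_control_affine {X E F : Type*} [PseudoMetricSpace X]
    [NormedAddCommGroup E] [NormedSpace ℝ E] [NormedAddCommGroup F] [NormedSpace ℝ F]
    {f : X → E} {g : X → F →L[ℝ] E} {μ : X → F} {z : X} (w : F)
    (hf : ∃ (L : NNReal), ∃ s ∈ 𝓝 z, LipschitzOnWith L f s)
    (hg : ∃ (L : NNReal), ∃ s ∈ 𝓝 z, LipschitzOnWith L g s)
    (hμ : ∃ (L : NNReal), ∃ s ∈ 𝓝 z, LipschitzOnWith L μ s) :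
    ∃ (L : NNReal), ∃ s ∈ 𝓝 z, LipschitzOnWith L (fun y => f y + g y (μ y + w)) s := by
  obtain ⟨Lf, sf, hsf, hLf⟩ := hf
  obtain ⟨Lg, sg, hsg, hLg⟩ := hg
  obtain ⟨Lμ, sμ, hsμ, hLμ⟩ := hμ
  -- Evaluation is Lipschitz only locally, being bilinear up to the shift by `w`; hence the
  -- neighborhood is cut down to where `(g, μ)` takes values in `sΨ`.
  have hΨ : ContDiff ℝ 1 fun q : (F →L[ℝ] E) × F => q.1 (q.2 + w) :=
    contDiff_fst.clm_apply (contDiff_snd.add contDiff_const)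
  obtain ⟨LΨ, sΨ, hsΨ, hLΨ⟩ := hΨ.locallyLipschitz (g z, μ z)
  have hφ := (hLg.mono inter_subset_left).prodMk (hLμ.mono (inter_subset_right (s := sg)))
  have hs : sg ∩ sμ ∈ 𝓝 z := inter_mem hsg hsμ
  refine ⟨_, sf ∩ (sg ∩ sμ ∩ (fun y => (g y, μ y)) ⁻¹' sΨ),
    inter_mem hsf (inter_mem hs ((hφ.continuousOn.continuousAt hs).preimage_mem_nhds hsΨ)),
    (hLf.mono inter_subset_left).add
      ((hLΨ.comp (hφ.mono inter_subset_left) fun y hy => hy.2).mono inter_subset_right)⟩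

namespace MultiRate

variable {n d : ℕ} {S : MultiRate n d}

/-! ### The low level: invariance of the safe pairs between transitions -/

theorem isClosed_safePairs (hhx : Continuous S.hx) (hhe : Continuous S.he) :
    IsClosed S.safePairs :=
  ((isClosed_le continuous_const hhx).preimage continuous_fst).inter
    ((isClosed_le continuous_const hhe).preimage (continuous_fst.sub continuous_snd))

/-- The two constraints involve `x` and `x - x̄`, which are independent coordinates of the pair.
Correcting directions for them can therefore be chosen separately, and no joint condition on the two
gradients is needed where both constraints are active. -/
theorem infDist_safePairs_le (hhx : Differentiable ℝ S.hx) (hhe : Differentiable ℝ S.he)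
    (hhx_reg : ∀ x ∈ frontier S.Sx, fderiv ℝ S.hx x ≠ 0)
    (hhe_reg : ∀ e ∈ frontier S.Se, fderiv ℝ S.he e ≠ 0)
    {z w : EuclideanSpace ℝ (Fin n) × EuclideanSpace ℝ (Fin n)} (hz : z ∈ S.safePairs)
    (hwx : S.hx z.1 = 0 → 0 ≤ fderiv ℝ S.hx z.1 w.1)
    (hwe : S.he (z.1 - z.2) = 0 → 0 ≤ fderiv ℝ S.he (z.1 - z.2) (w.1 - w.2))
    {ε : ℝ} (hε : 0 < ε) :
    ∀ᶠ δ in 𝓝[>] (0 : ℝ), Metric.infDist (z + δ • w) S.safePairs ≤ ε * δ := by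
  obtain ⟨q, hq⟩ := exists_forall_eventually_nonneg (hhx z.1) hz.1 hwx (hhx_reg z.1)
  obtain ⟨r, hr⟩ := exists_forall_eventually_nonneg (hhe (z.1 - z.2)) hz.2 hwe (hhe_reg (z.1 - z.2))
  -- This `p` moves the state by `q` and the error by `q - (q - r) = r`. Scaling it by `ε / (‖p‖ +
  -- 1)` keeps the displacement below `ε * δ`, also when `p = 0`.
  set p : EuclideanSpace ℝ (Fin n) × EuclideanSpace ℝ (Fin n) := (q, q - r) with hp
  have hε' : 0 < ε / (‖p‖ + 1) := by positivity
  filter_upwards [hq _ hε', hr _ hε', self_mem_nhdsWithin] with δ h1 h2 hδ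
  have hδ : 0 < δ := mem_Ioi.1 hδ
  have hmem : z + δ • (w + (ε / (‖p‖ + 1)) • p) ∈ S.safePairs := by
    refine ⟨by simpa [hp, Sx] using h1, ?_⟩
    have : (z + δ • (w + (ε / (‖p‖ + 1)) • p)).1 - (z + δ • (w + (ε / (‖p‖ + 1)) • p)).2 =
        z.1 - z.2 + δ • (w.1 - w.2 + (ε / (‖p‖ + 1)) • r) := by
      simp only [hp, Prod.fst_add, Prod.snd_add, Prod.smul_fst, Prod.smul_snd]
      module
    rw [this]
    exact h2
  refine (Metric.infDist_le_dist_of_mem hmem).trans ?_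
  have : z + δ • w - (z + δ • (w + (ε / (‖p‖ + 1)) • p)) = -(δ • (ε / (‖p‖ + 1)) • p) := by
    module
  rw [dist_eq_norm, this, norm_neg, norm_smul, norm_smul, Real.norm_of_nonneg hδ.le,
    Real.norm_of_nonneg hε'.le, mul_comm ε]
  gcongr
  rw [div_mul_eq_mul_div, div_le_iff₀ (by positivity)]
  nlinarith [norm_nonneg p]

theorem exists_lipschitzOnWith_augField (hf : LocallyLipschitz S.f) (hg : LocallyLipschitz S.g)
    {μ : EuclideanSpace ℝ (Fin n) × EuclideanSpace ℝ (Fin n) → EuclideanSpace ℝ (Fin d)}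
    {z : EuclideanSpace ℝ (Fin n) × EuclideanSpace ℝ (Fin n)} {w : EuclideanSpace ℝ (Fin d)}
    (hμ : ∃ (L : NNReal), ∃ s ∈ 𝓝 z, LipschitzOnWith L μ s) :
    ∃ (L : NNReal), ∃ s ∈ 𝓝 z, LipschitzOnWith L (fun y => S.augField y (μ y) w) s := by
  obtain ⟨L₁, s₁, hs₁, hL₁⟩ := exists_lipschitzOnWith_control_affine w
    ((hf.comp LipschitzWith.prod_fst.locallyLipschitz) z)
    ((hg.comp LipschitzWith.prod_fst.locallyLipschitz) z) hμ
  have h₂ : LipschitzWith (‖S.A‖₊ * 1)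
      fun y : EuclideanSpace ℝ (Fin n) × EuclideanSpace ℝ (Fin n) => S.A y.2 :=
    S.A.lipschitz.comp LipschitzWith.prod_snd
  exact ⟨_, s₁, hs₁, hL₁.prodMk
    ((h₂.add (LipschitzWith.const (S.B w))).lipschitzOnWith (s := s₁))⟩

/-- A solution of the augmented dynamics under the low level policy and a constant admissible high
level input stays in the set of safe pairs. -/
theorem mem_safePairs_of_flow
    (hα₁ : S.α₁ 0 = 0) (hα₂ : S.α₂ 0 = 0)
    (hf : LocallyLipschitz S.f) (hg : LocallyLipschitz S.g)
    (hhx : Differentiable ℝ S.hx) (hhe : Differentiable ℝ S.he)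
    (hhx_reg : ∀ x ∈ frontier S.Sx, fderiv ℝ S.hx x ≠ 0)
    (hhe_reg : ∀ e ∈ frontier S.Se, fderiv ℝ S.he e ≠ 0)
    {πu : EuclideanSpace ℝ (Fin n) × EuclideanSpace ℝ (Fin n) → EuclideanSpace ℝ (Fin d) →
      EuclideanSpace ℝ (Fin d)}
    {w : EuclideanSpace ℝ (Fin d)}
    (hπu : ∀ z ∈ S.safePairs, ∃ γ, S.QPFeasible z w (πu z w) γ)
    (hlip : ∀ z ∈ S.safePairs, ∃ (L : NNReal), ∃ s ∈ 𝓝 z, LipschitzOnWith L (fun y => πu y w) s)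
    {z : ℝ → EuclideanSpace ℝ (Fin n) × EuclideanSpace ℝ (Fin n)} {a b : ℝ}
    (hcont : ContinuousOn z (Icc a b))
    (hz : ∀ t ∈ Ioo a b, HasDerivAt z (S.augField (z t) (πu (z t) w) w) t)
    (ha : z a ∈ S.safePairs) :
    ∀ t ∈ Icc a b, z t ∈ S.safePairs := by
  refine mem_of_subtangential (G := fun y => S.augField y (πu y w) w)
    (isClosed_safePairs hhx.continuous hhe.continuous)
    (fun y hy => exists_lipschitzOnWith_augField hf hg (hlip y hy)) ?_ hcont hz ha
  intro y hy ε hε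
  obtain ⟨γ, hγ⟩ := hπu y hy
  refine infDist_safePairs_le hhx hhe hhx_reg hhe_reg hy (fun h => ?_) (fun h => ?_) hε
  -- Where the barrier function vanishes, `α 0 = 0` turns the constraint of the program into
  -- nonnegativity of the derivative along the field.
  · have := hγ.state_barrier
    rwa [h, hα₁, neg_zero] at this
  · have hb := hγ.error_barrier
    have hd : HasFDerivAt
        (fun y : EuclideanSpace ℝ (Fin n) × EuclideanSpace ℝ (Fin n) => S.he (y.1 - y.2)) _ y :=
      (hhe (y.1 - y.2)).hasFDerivAt.comp y (hasFDerivAt_fst.sub hasFDerivAt_snd)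
    rw [h, hα₂, neg_zero, hd.fderiv] at hb
    simpa using hb

/-! ### The high level: recursive feasibility of the tube MPC -/

/-- Unrolled, `tube (j + 1)` is the sum of the sets `Acl ^ i W` for `i ≤ j`. The recursion adds the
newest disturbance (`i = 0`), whereas shifting a plan in time requires splitting off the oldest (`i
= j`). -/
theorem iterate_add_mem_tube_succ {w : EuclideanSpace ℝ (Fin n)} (hw : w ∈ S.W) :
    ∀ (j : ℕ), ∀ s ∈ S.tube j, (S.Acl ^ j) w + s ∈ S.tube (j + 1)
  | 0, s, hs => by
    rw [show s = 0 from hs]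
    exact ⟨0, ⟨0, rfl, map_zero _⟩, w, hw, by simp⟩
  | j + 1, s, hs => by
    obtain ⟨_, ⟨s', hs', rfl⟩, w', hw', rfl⟩ := hs
    refine ⟨_, ⟨_, iterate_add_mem_tube_succ hw j s' hs', rfl⟩, w', hw', ?_⟩
    simp only [map_add, pow_succ', mul_apply_eq_comp]
    abel

/-- The initial state is imposed exactly, so the shifted plan must absorb `w`: its state `j` is
translated by `Acl ^ j w`. The tightening by `tube (j + 1)` in the old plan leaves room for this
translation and for `tube j`. The plan is extended by one step of the feedback `K` inside the
terminal set. With a horizon of at least one step, `vs 0` does lead to a predicted state. -/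
theorem OCPFeasible.successor (hN : 1 ≤ S.N) (hXF : S.XF ⊆ S.Xd ∩ S.Sx)
    (hXF_input : ∀ x ∈ S.XF, S.K x ∈ S.V) (hXF_inv : S.IsRobustPosInvariant S.XF)
    {x₀ : EuclideanSpace ℝ (Fin n)} {xs : ℕ → EuclideanSpace ℝ (Fin n)}
    {vs : ℕ → EuclideanSpace ℝ (Fin d)} (h : S.OCPFeasible x₀ xs vs)
    {w : EuclideanSpace ℝ (Fin n)} (hw : w ∈ S.W) :
    ∃ xs' vs', S.OCPFeasible (S.Acl (xs 0) + S.D (S.Bbar (vs 0)) + w) xs' vs' := by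
  obtain ⟨N, hNe⟩ : ∃ N, S.N = N + 1 := ⟨S.N - 1, by omega⟩
  let xs' : ℕ → EuclideanSpace ℝ (Fin n) := fun j =>
    if j ≤ N then xs (j + 1) + (S.Acl ^ j) w else S.Acl (xs (N + 1) + (S.Acl ^ N) w)
  -- The old variable `vs (N + 1)` drives no predicted step, so nothing is known about the state it
  -- would lead to. Zero is used from index `N` on, which leaves the feedback `K` that keeps `XF`
  -- invariant.
  let vs' : ℕ → EuclideanSpace ℝ (Fin d) := fun j => if j < N then vs (j + 1) else 0
  have hx1 : ∀ j ≤ N, xs' j = xs (j + 1) + (S.Acl ^ j) w := fun j hj => if_pos hj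
  have hx2 : xs' (N + 1) = S.Acl (xs (N + 1) + (S.Acl ^ N) w) := if_neg (by omega)
  have hv1 : ∀ j < N, vs' j = vs (j + 1) := fun j hj => if_pos hj
  have hv2 : ∀ j, N ≤ j → vs' j = 0 := fun j hj => if_neg (by omega)
  have hterm := h.terminal
  rw [hNe] at hterm
  have hF1 : ∀ s ∈ S.tube N, xs' N + s ∈ S.XF := fun s hs => by
    rw [hx1 N le_rfl, add_assoc]
    exact hterm _ (iterate_add_mem_tube_succ hw N s hs)
  -- The new terminal section is `Acl (xs' N + tube N) + W`, so robust invariance of `XF` applies to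
  -- it point by point.
  have hF2 : ∀ s ∈ S.tube (N + 1), xs' (N + 1) + s ∈ S.XF := by
    rintro _ ⟨_, ⟨s, hs, rfl⟩, w', hw', rfl⟩
    have := hXF_inv _ (hF1 s hs) w' hw'
    rwa [map_add, hx1 N le_rfl, ← hx2, add_assoc] at this
  refine ⟨xs', vs', ?_, ?_, ?_, ?_, ?_⟩
  · rw [hx1 0 (Nat.zero_le _), h.dyn 0 (by omega)]
    simp
  · intro j hj
    rcases lt_or_ge j N with hjN | hjN
    · rw [hx1 j hjN.le, hx1 (j + 1) hjN, hv1 j hjN, h.dyn (j + 1) (by omega), map_add, pow_succ',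
        mul_apply_eq_comp]
      abel
    · obtain rfl : j = N := by omega
      rw [hx2, hv2 j le_rfl, hx1 j le_rfl]
      simp
  · intro j hj s hs
    rcases le_or_gt j N with hjN | hjN
    · rw [hx1 j hjN, add_assoc]
      exact h.state (j + 1) (by omega) _ (iterate_add_mem_tube_succ hw j s hs)
    · obtain rfl : j = N + 1 := by omega
      exact hXF (hF2 s hs)
  · rintro j hj _ ⟨s, hs, rfl⟩
    rcases lt_or_ge j N with hjN | hjN
    · have := h.input (j + 1) (by omega) _ ⟨_, iterate_add_mem_tube_succ hw j s hs, rfl⟩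
      rw [map_add] at this
      rw [hx1 j hjN.le, hv1 j hjN, map_add]
      simpa only [add_assoc] using this
    · rw [hv2 j hjN, zero_add, ← map_add]
      refine hXF_input _ ?_
      obtain rfl | rfl : j = N ∨ j = N + 1 := by omega
      · exact hF1 s hs
      · exact hF2 s hs
  · rw [hNe]
    exact hF2

theorem OCPFeasible.state_mem {x₀ : EuclideanSpace ℝ (Fin n)}
    {xs : ℕ → EuclideanSpace ℝ (Fin n)} {vs : ℕ → EuclideanSpace ℝ (Fin d)}
    (h : S.OCPFeasible x₀ xs vs) : x₀ ∈ S.Xd ∩ S.Sx := by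
  have := h.state 0 (Nat.zero_le _) 0 rfl
  rwa [add_zero, h.init] at this

theorem OCPFeasible.input_mem {x₀ : EuclideanSpace ℝ (Fin n)}
    {xs : ℕ → EuclideanSpace ℝ (Fin n)} {vs : ℕ → EuclideanSpace ℝ (Fin d)}
    (h : S.OCPFeasible x₀ xs vs) : vs 0 + S.K (xs 0) ∈ S.V := by
  have := h.input 0 (Nat.zero_le _) 0 ⟨0, rfl, map_zero _⟩
  rwa [add_zero] at this

/-! ### The closed loop -/

theorem Abar_add_Bbar_apply (x : EuclideanSpace ℝ (Fin n)) (w : EuclideanSpace ℝ (Fin d)) :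
    S.Abar x + S.Bbar w = NormedSpace.exp (S.T • S.A) x +
      ∫ η in (0 : ℝ)..S.T, NormedSpace.exp ((S.T - η) • S.A) (S.B w) := by
  let _ : NormedAlgebra ℚ (EuclideanSpace ℝ (Fin n) →L[ℝ] EuclideanSpace ℝ (Fin n)) :=
    NormedAlgebra.restrictScalars ℚ ℝ _
  have hc : Continuous fun η : ℝ => (NormedSpace.exp ((S.T - η) • S.A)).comp S.B :=
    (NormedSpace.exp_continuous.comp
      ((continuous_const.sub continuous_id).smul continuous_const)).clm_comp continuous_const
  rw [Abar, Bbar, ContinuousLinearMap.intervalIntegral_apply (hc.intervalIntegrable _ _)]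
  rfl

variable {πu : EuclideanSpace ℝ (Fin n) × EuclideanSpace ℝ (Fin n) → EuclideanSpace ℝ (Fin d) →
      EuclideanSpace ℝ (Fin d)}
  {πv : EuclideanSpace ℝ (Fin n) → EuclideanSpace ℝ (Fin d)} {τ : EReal}
  {x xb : ℝ → EuclideanSpace ℝ (Fin n)} {u v : ℝ → EuclideanSpace ℝ (Fin d)}

theorem IsClosedLoop.xb_transition (hcl : S.IsClosedLoop πu πv τ x xb u v) (k : ℕ)
    (hk : ((k * S.T : ℝ) : EReal) < τ) : xb (k * S.T) = x (k * S.T) := by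
  rcases Nat.eq_zero_or_pos k with rfl | hpos
  · simpa using hcl.init_xb
  · obtain ⟨xm, -, h1, h2⟩ := hcl.jump k hpos hk
    rw [h1, h2]

theorem IsClosedLoop.hasDerivAt (hcl : S.IsClosedLoop πu πv τ x xb u v) {k : ℕ} {t : ℝ}
    (h1 : k * S.T < t) (h2 : t < (k + 1) * S.T) (hτ : (t : EReal) < τ) :
    HasDerivAt (fun s => (x s, xb s)) (S.augField (x t, xb t)
      (πu (x t, xb t) (πv (x (k * S.T)))) (πv (x (k * S.T)))) t := by
  have := hcl.flow k t h1 h2 hτ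
  rwa [hcl.low k t h1 h2 hτ, hcl.high k t h1.le h2 hτ] at this

theorem IsClosedLoop.continuousOn (hcl : S.IsClosedLoop πu πv τ x xb u v) {k : ℕ} {t : ℝ}
    (h2 : t < (k + 1) * S.T) (hτ : (t : EReal) < τ) :
    ContinuousOn (fun s => (x s, xb s)) (Icc (k * S.T) t) := by
  intro s hs
  have hsτ : (s : EReal) < τ := (EReal.coe_le_coe_iff.2 hs.2).trans_lt hτ
  rcases eq_or_lt_of_le hs.1 with rfl | hlt
  · have h : ContinuousWithinAt (fun s => (x s, xb s)) (Ioi (k * S.T)) (k * S.T) :=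
      (hcl.right_x k hsτ).prodMk_nhds (hcl.right_xb k hsτ)
    exact (continuousWithinAt_Ioi_iff_Ici.1 h).mono Icc_subset_Ici_self
  · exact (hcl.hasDerivAt hlt (hs.2.trans_lt h2) hsτ).continuousAt.continuousWithinAt

/-- The left limit of the planner state at a transition. -/
theorem IsClosedLoop.tendsto_xb (hT : 0 < S.T) (hcl : S.IsClosedLoop πu πv τ x xb u v) {k : ℕ}
    (hτ : (((k + 1 : ℕ) * S.T : ℝ) : EReal) < τ) :
    Tendsto xb (𝓝[<] ((k + 1 : ℕ) * S.T))
      (𝓝 (S.Abar (x (k * S.T)) + S.Bbar (πv (x (k * S.T))))) := by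
  have hlt : (k * S.T : ℝ) < (k + 1 : ℕ) * S.T := by
    push_cast
    linarith
  have hkτ : ((k * S.T : ℝ) : EReal) < τ := (EReal.coe_lt_coe_iff.2 hlt).trans hτ
  have heq : ((k + 1 : ℕ) * S.T : ℝ) = k * S.T + S.T := by
    push_cast
    ring
  rw [Abar_add_Bbar_apply, ← hcl.xb_transition k hkτ, heq]
  refine tendsto_linear_ode S.A (S.B (πv (xb (k * S.T)))) hT (fun t ht => ?_) (hcl.right_xb k hkτ)
  rw [← heq] at ht
  have htτ : (t : EReal) < τ := (EReal.coe_lt_coe_iff.2 ht.2).trans hτ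
  have := (hcl.hasDerivAt ht.1 (by simpa using ht.2) htτ).snd
  rw [hcl.xb_transition k hkτ]
  exact this

/-- The transition of the sampled state: a nominal step plus a disturbance from `W`. -/
theorem IsClosedLoop.exists_transition (hT : 0 < S.T) (hcl : S.IsClosedLoop πu πv τ x xb u v)
    (hSeBar : S.Se ⊆ S.SeBar) (hclosed : IsClosed S.safePairs) {k : ℕ}
    (hτ : (((k + 1 : ℕ) * S.T : ℝ) : EReal) < τ)
    (hsafe : ∀ t : ℝ, k * S.T ≤ t → t < (k + 1) * S.T → (t : EReal) < τ →
      (x t, xb t) ∈ S.safePairs) :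
    ∃ z ∈ S.safePairs, Tendsto (fun t => (x t, xb t)) (𝓝[<] ((k + 1 : ℕ) * S.T)) (𝓝 z) ∧
      ∃ w ∈ S.W, x ((k + 1 : ℕ) * S.T) =
        S.D (S.Abar (x (k * S.T)) + S.Bbar (πv (x (k * S.T)))) + w := by
  obtain ⟨xm, hxm, hjump, -⟩ := hcl.jump (k + 1) (Nat.le_add_left 1 k) hτ
  have hlim := hxm.prodMk_nhds (hcl.tendsto_xb hT hτ)
  have hmem : (xm, S.Abar (x (k * S.T)) + S.Bbar (πv (x (k * S.T)))) ∈ S.safePairs := by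
    refine hclosed.mem_of_tendsto hlim ?_
    filter_upwards [Ioo_mem_nhdsLT (show (k * S.T : ℝ) < (k + 1 : ℕ) * S.T by
      push_cast; linarith)] with t ht
    exact hsafe t ht.1.le (by simpa using ht.2) ((EReal.coe_lt_coe_iff.2 ht.2).trans hτ)
  refine ⟨_, hmem, hlim, _, ⟨_, hSeBar hmem.2, rfl⟩, ?_⟩
  -- With `x⁻ = x̄⁻ + e`, the affine reset splits as `Δ(x⁻) = D x̄⁻ + Δ(e)`: the offset `p` is
  -- carried by the disturbance, and the nominal model stays linear.
  rw [hjump, reset, reset, ← add_assoc, ← map_add, add_sub_cancel]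

end MultiRate

/-! ### Constraint satisfaction along the closed loop -/

theorem theorem2 {n d : ℕ} (S : MultiRate n d)
    -- period, horizon and weights
    (hT : 0 < S.T) (hN : 1 ≤ S.N) (hc₁ : 0 < S.c₁) (hc₂ : 0 < S.c₂)
    (hα₁ : IsExtendedClassK S.α₁) (hα₂ : IsExtendedClassK S.α₂)
    -- regularity of the plant and of the barrier functions
    (hf : LocallyLipschitz S.f) (hg : LocallyLipschitz S.g)
    (hhx : ContDiff ℝ 1 S.hx) (hhe : ContDiff ℝ 1 S.he)
    (hhx_reg : ∀ x ∈ frontier S.Sx, fderiv ℝ S.hx x ≠ 0)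
    (hhe_reg : ∀ e ∈ frontier S.Se, fderiv ℝ S.he e ≠ 0)
    -- relations between the sets
    (hSx : S.Sx ⊆ S.Xc) (hXd : S.Xd ⊆ S.Xc)
    (hSe : 0 ∈ S.Se) (hSeBar : S.Se ⊆ S.SeBar)
    -- feasibility of the quadratic program
    (hQP : ∀ z ∈ S.safePairs, ∀ v ∈ S.V, ∃ u γ, S.QPFeasible z v u γ)
    -- the terminal set is admissible and robust positively invariant
    (hXF : S.XF ⊆ S.Xd ∩ S.Sx) (hXF_input : ∀ x ∈ S.XF, S.K x ∈ S.V)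
    (hXF_inv : S.IsRobustPosInvariant S.XF)
    -- the policies
    (πu : EuclideanSpace ℝ (Fin n) × EuclideanSpace ℝ (Fin n) → EuclideanSpace ℝ (Fin d) →
      EuclideanSpace ℝ (Fin d))
    (πv : EuclideanSpace ℝ (Fin n) → EuclideanSpace ℝ (Fin d))
    (hπu : S.IsLowLevelPolicy πu) (hπv : S.IsHighLevelPolicy πv)
    (hπu_lip : ∀ v ∈ S.V, ∀ z ∈ S.safePairs,
      ∃ (L : NNReal), ∃ s ∈ 𝓝 z, LipschitzOnWith L (fun y => πu y v) s)
    -- a closed-loop trajectory on `[0, τ)`, with `τ` possibly infinite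
    (τ : EReal) (x xb : ℝ → EuclideanSpace ℝ (Fin n)) (u v : ℝ → EuclideanSpace ℝ (Fin d))
    (hcl : S.IsClosedLoop πu πv τ x xb u v)
    -- feasibility at the initial time
    (hfeas : ∃ xs vs, S.OCPFeasible (x 0) xs vs) :
    (∀ (k : ℕ) (t : ℝ), k * S.T < t → t < (k + 1) * S.T → (t : EReal) < τ → x t ∈ S.Xc) ∧
    (∀ k : ℕ, ((k * S.T : ℝ) : EReal) < τ → x (k * S.T) ∈ S.Xd) ∧
    (∀ t : ℝ, 0 ≤ t → (t : EReal) < τ → u t ∈ S.U ∧ v t ∈ S.V) := by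
  have hdx := hhx.differentiable one_ne_zero
  have hde := hhe.differentiable one_ne_zero
  have hclosed : IsClosed S.safePairs := MultiRate.isClosed_safePairs hdx.continuous hde.continuous
  have hπu' : ∀ w ∈ S.V, ∀ z ∈ S.safePairs, ∃ γ, S.QPFeasible z w (πu z w) γ :=
    fun w hw z hz => (hπu z w (hQP z hz w hw)).imp fun γ h => h.1
  have hvmem : ∀ k : ℕ, (∃ xs vs, S.OCPFeasible (x (k * S.T)) xs vs) → πv (x (k * S.T)) ∈ S.V := by
    intro k hk
    obtain ⟨xs, vs, hopt, heq⟩ := hπv _ hk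
    exact heq ▸ hopt.1.input_mem
  have hsafe : ∀ k : ℕ, (∃ xs vs, S.OCPFeasible (x (k * S.T)) xs vs) → ∀ t : ℝ, k * S.T ≤ t →
      t < (k + 1) * S.T → (t : EReal) < τ → (x t, xb t) ∈ S.safePairs := by
    intro k hk t h1 h2 hτ
    have hkτ : ((k * S.T : ℝ) : EReal) < τ := (EReal.coe_le_coe_iff.2 h1).trans_lt hτ
    obtain ⟨xs, vs, hF⟩ := id hk
    refine MultiRate.mem_safePairs_of_flow hα₁.map_zero hα₂.map_zero hf hg hdx hde hhx_reg hhe_reg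
      (hπu' _ (hvmem k hk)) (hπu_lip _ (hvmem k hk)) (hcl.continuousOn h2 hτ) (fun s hs => ?_)
      ⟨hF.state_mem.2, ?_⟩ t ⟨h1, le_rfl⟩
    · exact hcl.hasDerivAt hs.1 (hs.2.trans h2) ((EReal.coe_lt_coe_iff.2 hs.2).trans hτ)
    · rw [hcl.xb_transition k hkτ, sub_self]
      exact hSe
  have hfeas_all : ∀ k : ℕ, ((k * S.T : ℝ) : EReal) < τ →
      ∃ xs vs, S.OCPFeasible (x (k * S.T)) xs vs := by
    intro k
    induction k with
    | zero => simpa using fun _ => hfeas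
    | succ k ih =>
      intro hτ
      have hk := ih (lt_of_le_of_lt (EReal.coe_le_coe_iff.2 (by push_cast; linarith)) hτ)
      obtain ⟨z, -, -, w, hw, hx⟩ := hcl.exists_transition hT hSeBar hclosed hτ (hsafe k hk)
      obtain ⟨xs, vs, hopt, heq⟩ := hπv _ hk
      obtain ⟨xs', vs', h'⟩ := hopt.1.successor hN hXF hXF_input hXF_inv hw
      refine ⟨xs', vs', ?_⟩
      convert h' using 1
      -- Substituting `vs 0 + K (xs 0)` for the applied input turns the sampled step into `Acl (xs
      -- 0) + D (Bbar (vs 0))`.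
      rw [hx, heq, ← hopt.1.init]
      simp only [MultiRate.Acl, ContinuousLinearMap.comp_apply, add_apply, map_add]
      abel
  refine ⟨fun k t h1 h2 hτ => ?_, fun k hτ => ?_, fun t ht hτ => ?_⟩
  · have hkτ := (EReal.coe_lt_coe_iff.2 h1).trans hτ
    exact hSx (hsafe k (hfeas_all k hkτ) t h1.le h2 hτ).1
  · obtain ⟨xs, vs, hF⟩ := hfeas_all k hτ
    exact hF.state_mem.1
  · obtain ⟨k, h1, h2⟩ : ∃ k : ℕ, k * S.T ≤ t ∧ t < (k + 1) * S.T :=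
      ⟨⌊t / S.T⌋₊, (le_div_iff₀ hT).1 (Nat.floor_le (by positivity)),
        (div_lt_iff₀ hT).1 (Nat.lt_floor_add_one _)⟩
    have hkτ : ((k * S.T : ℝ) : EReal) < τ := (EReal.coe_le_coe_iff.2 h1).trans_lt hτ
    have hk := hfeas_all k hkτ
    have hv := hcl.high k t h1 h2 hτ
    refine ⟨?_, hv ▸ hvmem k hk⟩
    have hinU : u t = πu (x t, xb t) (v t) → u t ∈ S.U := by
      intro h
      obtain ⟨γ, hγ⟩ := hπu' _ (hvmem k hk) _ (hsafe k hk t h1 h2 hτ)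
      rw [h, hv]
      exact hγ.input
    rcases eq_or_lt_of_le h1 with rfl | hlt
    · cases k with
      | zero => exact hinU (by simpa using hcl.init_u)
      | succ k =>
        -- At a transition `u` is a left limit, and `U` is not assumed closed. Instead, the pair has
        -- a left limit `z` in `safePairs`, and `πu` is continuous at `z`, so `u` takes the value of
        -- the policy at `z` under the input of the previous period, which the quadratic program
        -- places in `U`.
        have hk := hfeas_all k
          (lt_of_le_of_lt (EReal.coe_le_coe_iff.2 (by push_cast; linarith)) hkτ)
        obtain ⟨z, hz, hlim, -⟩ := hcl.exists_transition hT hSeBar hclosed hkτ (hsafe k hk)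
        obtain ⟨L, s, hs, hL⟩ := hπu_lip _ (hvmem k hk) z hz
        have hu : Tendsto u (𝓝[<] ((k + 1 : ℕ) * S.T)) (𝓝 (πu z (πv (x (k * S.T))))) := by
          refine ((hL.continuousOn.continuousAt hs).tendsto.comp hlim).congr' ?_
          filter_upwards [Ioo_mem_nhdsLT (show (k * S.T : ℝ) < (k + 1 : ℕ) * S.T by
            push_cast; linarith)] with t ht
          have htτ := (EReal.coe_lt_coe_iff.2 ht.2).trans hτ
          have ht2 : t < (k + 1) * S.T := by simpa using ht.2
          rw [hcl.low k t ht.1 ht2 htτ, hcl.high k t ht.1.le ht2 htτ]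
          rfl
        obtain ⟨γ, hγ⟩ := hπu' _ (hvmem k hk) z hz
        rw [tendsto_nhds_unique (hcl.jump_u (k + 1) (Nat.le_add_left 1 k) hkτ) hu]
        exact hγ.input
    · exact hinU (hcl.low k t hlt h2 hτ)
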